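/- Call a closed polygonal curve $q_1q_2\cdots q_mq_1$ contained in a closed convex set $K\subseteq\mathbb{R}^2$, with $q_i\neq q_{i+1}$ and with a change of direction at every vertex (indices modulo $m$), a closed generalized billiard trajectory of $K$ if every vertex $q_i$ lies on $\partial K$ and at every $q_i$ the curve is reflected in some supporting line of $K$ at $q_i$, that is, the unit vector $\frac{q_{i+1}-q_i}{|q_{i+1}-q_i|}$ is the mirror image of $\frac{q_i-q_{i-1}}{|q_i-q_{i-1}|}$ in the direction of that line. Let $\alpha(K)\in[0,\infty]$ be the infimum of the lengths $\sum_{i=1}^m|q_{i+1}-q_i|$ of the closed generalized billiard trajectories of $K$, over all $m$, with $\alpha(K)=\infty$ if there are none. For a planar convex body $K$ and $z\in\mathbb{R}^2$ let $K^z=\{y\in\mathbb{R}^2 : \langle x-z,y\rangle\le 1 \text{ for all } x\in K\}$ be the dual body of $K$ with respect to $z$, and let \[\beta(K)=\inf_{z\in\mathbb{R}^2}\alpha(K)\,\alpha(K^z)\] be the billiard product of $K$. Then for every (non-degenerate, closed, filled) triangle $T\subseteq\mathbb{R}^2$ one has $\beta(T)\le 12$. Moreover, $\beta(T)=12$ if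 and only if $T$ is equilateral. -/

import Mathlib

open scoped ENNReal RealInnerProductSpace

/-- The unit vector in the direction of `v` (for `v ≠ 0`). -/
noncomputable def unitDir {E : Type*} [NormedAddCommGroup E] [InnerProductSpace ℝ E] (v : E) : E :=
  ‖v‖⁻¹ • v

/-- The hyperplane through `p` orthogonal to the unit vector `n` is a supporting hyperplane of `K`
at the point `p ∈ K`, with `n` as outer unit normal. -/
def IsOuterUnitNormal {E : Type*} [NormedAddCommGroup E] [InnerProductSpace ℝ E]
    (K : Set E) (p n : E) : Prop :=
  p ∈ K ∧ ‖n‖ = 1 ∧ ∀ x ∈ K, ⟪n, x⟫ ≤ ⟪n, p⟫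

/-- The closed polygonal curve `q 0, q 1, …, q (m - 1), q 0` (indices are cyclic) is a closed
generalized billiard trajectory of `K`. The `q i` are exactly the points where the curve is not
smooth: it has no edge of length zero and its direction changes at every vertex. -/
structure IsClosedBilliardTrajectory {E : Type*} [NormedAddCommGroup E] [InnerProductSpace ℝ E]
    (K : Set E) {m : ℕ} [NeZero m] (q : Fin m → E) : Prop where
  /-- Consecutive vertices are distinct. -/
  ne_next : ∀ i, q i ≠ q (i + 1)
  /-- The curve is contained in `K`. -/
  segment_subset : ∀ i, segment ℝ (q i) (q (i + 1)) ⊆ K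
  /-- The curve turns at every vertex. -/
  turns : ∀ i, unitDir (q (i + 1 + 1) - q (i + 1)) ≠ unitDir (q (i + 1) - q i)
  /-- All vertices lie on the boundary of `K`. -/
  mem_frontier : ∀ i, q i ∈ frontier K
  /-- At every vertex the outgoing direction is the mirror image of the incoming direction in
  some supporting hyperplane of `K` at that vertex. -/
  reflects : ∀ i, ∃ n : E, IsOuterUnitNormal K (q (i + 1)) n ∧
    unitDir (q (i + 1 + 1) - q (i + 1)) =
      unitDir (q (i + 1) - q i) - (2 * ⟪n, unitDir (q (i + 1) - q i)⟫) • n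

/-- The perimeter of the closed polygon `q 0, …, q (m - 1), q 0`. -/
noncomputable def closedLength {E : Type*} [NormedAddCommGroup E] [InnerProductSpace ℝ E]
    {m : ℕ} [NeZero m] (q : Fin m → E) : ℝ :=
  ∑ i, dist (q i) (q (i + 1))

/-- `α(K)`: the infimum of the lengths of the closed generalized billiard trajectories of `K`,
and `∞` if there are none. -/
noncomputable def billiardLength {E : Type*} [NormedAddCommGroup E] [InnerProductSpace ℝ E]
    (K : Set E) : ℝ≥0∞ :=
  ⨅ (m : ℕ) (_ : NeZero m) (q : Fin m → E) (_ : IsClosedBilliardTrajectory K q),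
    ENNReal.ofReal (closedLength q)

/-- The dual body `K^z` of `K` with respect to the center `z`. -/
def dualBody {E : Type*} [NormedAddCommGroup E] [InnerProductSpace ℝ E] (K : Set E) (z : E) :
    Set E :=
  {y | ∀ x ∈ K, ⟪x - z, y⟫ ≤ 1}

/-- The billiard product `β(K)`. -/
noncomputable def billiardProduct {E : Type*} [NormedAddCommGroup E] [InnerProductSpace ℝ E]
    (K : Set E) : ℝ≥0∞ :=
  ⨅ z : E, billiardLength K * billiardLength (dualBody K z)

/-!
Upper bound. Let `BC` be a longest side of the triangle, of length `a`, and take the midpoint of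
`BC` as the centre `z`. The dual with respect to `z` is unbounded and lies in a strip of width
`4 / a`; a segment across the strip, run back and forth, is a trajectory of length `8 / a`
(`billiardLength_dualBody_midpoint_le`). In the triangle itself the orthic triangle is a trajectory
if the triangle is acute (`billiardLength_triangle_le_orthic`), and otherwise the altitude on `BC`
is one (`billiardLength_triangle_le_altitude`). Its length is less than `3 a / 2`, except in the
equilateral case, where it equals `3 a / 2`. So the product is at most `12`, and less than `12`
unless the triangle is equilateral (`billiardProduct_triangle_le`).

Lower bound for an equilateral triangle of side `s`. The normals at the vertices of a trajectory
have a vanishing positive combination, so a trajectory cannot be translated into the interior of the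
body. If the body contains `{y | ∀ i, ⟪w i, y⟫ ≤ b i}`, Gordan's alternative turns this into weights
`l i` of sum `1` with `∑ l i • w i = 0` and vertices `p i` of the trajectory with
`∑ l i * b i ≤ ∑ ⟪l i • w i, p i⟫` (`IsClosedBilliardTrajectory.exists_vertices`). The vectors
`l i • w i` are the edges of a triangle. If this triangle lies in a disc of radius `R`, the right
side is at most `R` times the perimeter of the triangle of the `p i`, hence at most `R` times the
length of the trajectory (`sum_inner_edges_le`, `triangle_perimeter_le_closedLength`).

For the dual body `w i = v i - z` and `b i = 1`, so the `l i` are barycentric coordinates of `z`.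
The edge triangle then has the vertices `l i * l j • (v i - v j)`. Its circumradius is at most
`s / 8` by Schur's inequality (`exists_circumcircle`, `circumradius_sq_le`), and all trajectories of
all duals have length at least `8 / s`. This includes the unbounded duals, for `z` on the boundary;
for `z` outside the triangle there are no trajectories. For the equilateral triangle itself the `w i`
point from the vertices to the centroid, the weights are `1 / 3`, the radius is `s / 9`, and the
length is at least `3 s / 2`.
-/

/-! ### Criteria for billiard trajectories -/

section Trajectories

variable {E : Type*} [NormedAddCommGroup E] [InnerProductSpace ℝ E]

/-- A sufficient criterion for being a closed billiard trajectory. Two unit vectors `u ≠ u'` are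
always mirror images in the hyperplane orthogonal to `u - u'`, so the law of reflection at a vertex
only asks that `u - u'` be an outer normal there. Such a vertex is automatically a boundary
point. -/
lemma isClosedBilliardTrajectory_of_support {K : Set E} (hK : Convex ℝ K) {m : ℕ} [NeZero m]
    {q u : Fin m → E} (hq : ∀ i, q i ∈ K) (hne : ∀ i, q i ≠ q (i + 1))
    (hu : ∀ i, unitDir (q (i + 1) - q i) = u i) (hturn : ∀ i, u (i + 1) ≠ u i)
    (hsupp : ∀ i, ∀ x ∈ K, ⟪u i - u (i + 1), x⟫ ≤ ⟪u i - u (i + 1), q (i + 1)⟫) :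
    IsClosedBilliardTrajectory K q := by
  have hunit : ∀ i, ‖u i‖ = 1 := by
    intro i
    have h0 : ‖q (i + 1) - q i‖ ≠ 0 := by
      rw [norm_ne_zero_iff, sub_ne_zero]; exact (hne i).symm
    rw [← hu, unitDir, norm_smul, norm_inv, norm_norm, inv_mul_cancel₀ h0]
  have hpos : ∀ i, 0 < ‖u i - u (i + 1)‖ := fun i =>
    norm_pos_iff.2 (sub_ne_zero.2 (hturn i).symm)
  refine ⟨hne, fun i => hK.segment_subset (hq _) (hq _), fun i => ?_, fun i => ?_, fun i => ?_⟩
  · rw [hu, hu]; exact hturn i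
  · refine ⟨subset_closure (hq i), fun hint => ?_⟩
    obtain ⟨j, rfl⟩ : ∃ j, j + 1 = i := ⟨i - 1, sub_add_cancel i 1⟩
    set n := u j - u (j + 1) with hn
    have hcont : Filter.Tendsto (fun t : ℝ => q (j + 1) + t • n) (nhdsWithin 0 (Set.Ioi 0))
        (nhds (q (j + 1))) := by
      have : Continuous (fun t : ℝ => q (j + 1) + t • n) := by fun_prop
      have h := this.tendsto 0
      simp only [zero_smul, add_zero] at h
      exact h.mono_left nhdsWithin_le_nhds
    obtain ⟨t, htK, ht⟩ := ((hcont.eventually (mem_interior_iff_mem_nhds.1 hint)).and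
      self_mem_nhdsWithin).exists
    have h1 := hsupp j _ htK
    rw [← hn, inner_add_right, inner_smul_right, real_inner_self_eq_norm_sq] at h1
    have h2 : 0 < t * ‖n‖ ^ 2 := mul_pos ht (pow_pos (hpos j) 2)
    linarith
  · refine ⟨‖u i - u (i + 1)‖⁻¹ • (u i - u (i + 1)), ⟨hq _, ?_, fun x hx => ?_⟩, ?_⟩
    · rw [norm_smul, norm_inv, norm_norm, inv_mul_cancel₀ (hpos i).ne']
    · rw [inner_smul_left, inner_smul_left]
      exact mul_le_mul_of_nonneg_left (hsupp i x hx) (by simp)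
    · rw [hu, hu, inner_smul_left, smul_smul]
      have h1 : ‖u i - u (i + 1)‖ ^ 2 = 2 * ⟪u i - u (i + 1), u i⟫ := by
        rw [norm_sub_sq_real, inner_sub_left, real_inner_self_eq_norm_sq, hunit, hunit,
          real_inner_comm]
        ring
      have h2 : 2 * ((starRingEnd ℝ) ‖u i - u (i + 1)‖⁻¹ * ⟪u i - u (i + 1), u i⟫) *
          ‖u i - u (i + 1)‖⁻¹ = 1 := by
        have := (hpos i).ne'
        simp only [conj_trivial]
        field_simp
        linarith
      rw [h2, one_smul]
      abel

lemma billiardLength_le_closedLength {K : Set E} {m : ℕ} [hm : NeZero m] {q : Fin m → E}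
    (hq : IsClosedBilliardTrajectory K q) : billiardLength K ≤ ENNReal.ofReal (closedLength q) :=
  iInf_le_of_le m (iInf_le_of_le hm (iInf_le_of_le q (iInf_le_of_le hq le_rfl)))

lemma unitDir_smul {u : E} (hu : ‖u‖ = 1) {t : ℝ} (ht : 0 < t) : unitDir (t • u) = u := by
  rw [unitDir, norm_smul, hu, mul_one, Real.norm_of_nonneg ht.le, smul_smul,
    inv_mul_cancel₀ ht.ne', one_smul]

/-- A double normal of a convex set, run back and forth, is a billiard trajectory. -/
lemma billiardLength_le_of_double_normal {K : Set E} (hK : Convex ℝ K) {P Q : E}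
    (hP : P ∈ K) (hQ : Q ∈ K) (hne : P ≠ Q)
    (hsup : ∀ x ∈ K, ⟪Q - P, x⟫ ≤ ⟪Q - P, Q⟫) (hinf : ∀ x ∈ K, ⟪Q - P, P⟫ ≤ ⟪Q - P, x⟫) :
    billiardLength K ≤ ENNReal.ofReal (2 * dist P Q) := by
  have hpos : 0 < ‖Q - P‖ := norm_pos_iff.2 (sub_ne_zero.2 hne.symm)
  set d := unitDir (Q - P) with hd
  have hneg : unitDir (P - Q) = -d := by
    rw [hd, unitDir, unitDir, ← smul_neg, neg_sub, norm_sub_rev]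
  have hd0 : d ≠ 0 := smul_ne_zero (inv_ne_zero hpos.ne') (sub_ne_zero.2 hne.symm)
  have hdneg : -d ≠ d := fun h => by
    have h2 : (2 : ℝ) • d = 0 := by
      rw [two_smul]
      nth_rewrite 1 [← h]
      exact neg_add_cancel d
    exact hd0 ((smul_eq_zero.1 h2).resolve_left two_ne_zero)
  have hin : ∀ x y : E, ⟪Q - P, x⟫ ≤ ⟪Q - P, y⟫ → ⟪d, x⟫ ≤ ⟪d, y⟫ := by
    intro x y h
    rw [hd, unitDir, inner_smul_left, inner_smul_left]
    exact mul_le_mul_of_nonneg_left h (by simp)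
  have htraj : IsClosedBilliardTrajectory K ![P, Q] := by
    refine isClosedBilliardTrajectory_of_support hK (u := ![d, -d]) ?_ ?_ ?_ ?_ ?_
    · intro i; fin_cases i <;> simp [hP, hQ]
    · intro i; fin_cases i <;> simp [hne, hne.symm]
    · intro i; fin_cases i <;> simp [hneg, ← hd]
    · intro i; fin_cases i <;> simp [hdneg, hdneg.symm]
    · intro i x hx
      have h1 := hin _ _ (hsup x hx)
      have h2 := hin _ _ (hinf x hx)
      fin_cases i <;> simp [inner_add_left, inner_sub_left] <;> linarith
  refine (billiardLength_le_closedLength htraj).trans (ENNReal.ofReal_le_ofReal ?_)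
  simp [closedLength, Fin.sum_univ_two, dist_comm Q P, two_mul]

/-- A triangle with edges of length `x, y, z` in the directions of the unit vectors `u, v, w`, whose
changes of direction are outer normals at the vertices, is a billiard trajectory. -/
lemma billiardLength_le_of_triangle {K : Set E} (hK : Convex ℝ K) {P Q R u v w : E} {x y z : ℝ}
    (hP : P ∈ K) (hQ : Q ∈ K) (hR : R ∈ K) (hx : 0 < x) (hy : 0 < y) (hz : 0 < z)
    (hu : ‖u‖ = 1) (hv : ‖v‖ = 1) (hw : ‖w‖ = 1)
    (hPQ : Q - P = x • u) (hQR : R - Q = y • v) (hRP : P - R = z • w)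
    (huv : u ≠ v) (hvw : v ≠ w) (hwu : w ≠ u)
    (hsQ : ∀ p ∈ K, ⟪u - v, p⟫ ≤ ⟪u - v, Q⟫) (hsR : ∀ p ∈ K, ⟪v - w, p⟫ ≤ ⟪v - w, R⟫)
    (hsP : ∀ p ∈ K, ⟪w - u, p⟫ ≤ ⟪w - u, P⟫) :
    billiardLength K ≤ ENNReal.ofReal (x + y + z) := by
  have key : ∀ {A B d : E} {t : ℝ}, 0 < t → ‖d‖ = 1 → B - A = t • d →
      A ≠ B ∧ dist A B = t ∧ unitDir (B - A) = d := by
    intro A B d t ht hd h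
    have hdist : dist A B = t := by
      rw [dist_comm, dist_eq_norm, h, norm_smul, hd, mul_one, Real.norm_of_nonneg ht.le]
    exact ⟨fun hAB => by simp [hAB] at hdist; linarith, hdist, h ▸ unitDir_smul hd ht⟩
  obtain ⟨hne1, hd1, hu1⟩ := key hx hu hPQ
  obtain ⟨hne2, hd2, hu2⟩ := key hy hv hQR
  obtain ⟨hne3, hd3, hu3⟩ := key hz hw hRP
  have htraj : IsClosedBilliardTrajectory K ![P, Q, R] := by
    refine isClosedBilliardTrajectory_of_support hK (u := ![u, v, w]) ?_ ?_ ?_ ?_ ?_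
    · intro i; fin_cases i <;> simpa
    · intro i; fin_cases i <;> simpa
    · intro i; fin_cases i <;> simpa
    · intro i; fin_cases i
      · simpa using huv.symm
      · simpa using hvw.symm
      · simpa using hwu.symm
    · intro i p hp
      fin_cases i
      · simpa using hsQ p hp
      · simpa using hsR p hp
      · simpa using hsP p hp
  refine (billiardLength_le_closedLength htraj).trans (ENNReal.ofReal_le_ofReal (le_of_eq ?_))
  simp [closedLength, Fin.sum_univ_three, hd1, hd2, hd3]

end Trajectories

/-! ### Trajectories in a triangle and in its dual at the midpoint of a side -/

section Triangles

variable {E : Type*} [NormedAddCommGroup E] [InnerProductSpace ℝ E]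

lemma inner_le_of_mem_convexHull_triple {A B C n : E} {r : ℝ} (hA : ⟪n, A⟫ ≤ r) (hB : ⟪n, B⟫ ≤ r)
    (hC : ⟪n, C⟫ ≤ r) {x : E} (hx : x ∈ convexHull ℝ {A, B, C}) : ⟪n, x⟫ ≤ r := by
  have hconv : Convex ℝ {y : E | ⟪n, y⟫ ≤ r} := convex_halfSpace_le (innerₛₗ ℝ n).isLinear r
  refine convexHull_min ?_ hconv hx
  rintro y (rfl | rfl | rfl) <;> assumption

/-- The reflection of the orthic triangle at the foot of the altitude on the side `CA`. Here
`X, Y, Z` are the edge vectors `C - B`, `A - C`, `B - A`, of lengths `a, b, c`, and `α, β, γ` stand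
for `bc cos A`, `ca cos B`, `ab cos C`. -/
lemma orthic_reflection {X Y Z : E} {a b c α β γ : ℝ} (ha : 0 < a)
    (hb : 0 < b) (hc : 0 < c) (hα : 0 < α) (hβ : 0 < β) (hγ : 0 < γ) (hXX : ⟪X, X⟫ = a ^ 2) (hYY : ⟪Y, Y⟫ = b ^ 2)
    (hXY : ⟪X, Y⟫ = -γ) (hYZ : ⟪Y, Z⟫ = -α) (hZX : ⟪Z, X⟫ = -β)
    (ha2 : a ^ 2 = β + γ) (hb2 : b ^ 2 = γ + α) (hc2 : c ^ 2 = α + β) :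
    let n := ((b / (a * c)) • X + (a / (b * c)) • Y) - ((c / (b * a)) • Y + (b / (c * a)) • Z)
    ⟪n, Y⟫ = 0 ∧ 0 < ⟪n, X⟫ ∧ ‖(b / (a * c)) • X + (a / (b * c)) • Y‖ = 1 := by
  intro n
  have hYX : ⟪Y, X⟫ = -γ := by rw [real_inner_comm, hXY]
  have hZY : ⟪Z, Y⟫ = -α := by rw [real_inner_comm, hYZ]
  refine ⟨?_, ?_, ?_⟩
  · simp only [n, inner_sub_left, inner_add_left, inner_smul_left, conj_trivial, hXY, hYY, hZY]
    field_simp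
    rw [ha2, hc2]; ring
  · simp only [n, inner_sub_left, inner_add_left, inner_smul_left, conj_trivial, hXX, hYX, hZX]
    have : b / (a * c) * a ^ 2 + a / (b * c) * -γ - (c / (b * a) * -γ + b / (c * a) * -β) =
        2 * (α * β + β * γ + γ * α) / (a * b * c) := by
      field_simp
      rw [ha2, hb2, hc2]; ring
    rw [this]
    positivity
  · rw [← sq_eq_sq₀ (norm_nonneg _) zero_le_one, ← real_inner_self_eq_norm_sq]
    simp only [inner_add_left, inner_add_right, inner_smul_left, inner_smul_right, conj_trivial,
      hXX, hYX, hXY, hYY]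
    field_simp
    rw [ha2, hb2, hc2]; ring

/-- The orthic triangle of an acute triangle is a billiard trajectory. Its perimeter is
`a cos A + b cos B + c cos C`, written here in terms of `α = bc cos A`, `β = ca cos B` and
`γ = ab cos C`. -/
lemma billiardLength_triangle_le_orthic {A B C : E} {a b c α β γ : ℝ}
    (ha : 0 < a) (hb : 0 < b) (hc : 0 < c) (hα : 0 < α) (hβ : 0 < β) (hγ : 0 < γ)
    (hXX : ⟪C - B, C - B⟫ = a ^ 2) (hYY : ⟪A - C, A - C⟫ = b ^ 2) (hZZ : ⟪B - A, B - A⟫ = c ^ 2)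
    (hXY : ⟪C - B, A - C⟫ = -γ) (hYZ : ⟪A - C, B - A⟫ = -α) (hZX : ⟪B - A, C - B⟫ = -β)
    (ha2 : a ^ 2 = β + γ) (hb2 : b ^ 2 = γ + α) (hc2 : c ^ 2 = α + β) :
    billiardLength (convexHull ℝ {A, B, C}) ≤
      ENNReal.ofReal (2 * (α * β + β * γ + γ * α) / (a * b * c)) := by
  obtain ⟨hE0, hE1, hu⟩ := orthic_reflection (X := C - B) (Y := A - C) (Z := B - A)
    ha hb hc hα hβ hγ hXX hYY hXY hYZ hZX ha2 hb2 hc2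
  obtain ⟨hF0, hF1, hv⟩ := orthic_reflection (X := A - C) (Y := B - A) (Z := C - B)
    hb hc ha hβ hγ hα hYY hZZ hYZ hZX hXY hb2 hc2 ha2
  obtain ⟨hD0, hD1, hw⟩ := orthic_reflection (X := B - A) (Y := C - B) (Z := A - C)
    hc ha hb hγ hα hβ hZZ hXX hZX hXY hYZ hc2 ha2 hb2
  set u := (b / (a * c)) • (C - B) + (a / (b * c)) • (A - C)
  set v := (c / (b * a)) • (A - C) + (b / (c * a)) • (B - A)
  set w := (a / (c * b)) • (B - A) + (c / (a * b)) • (C - B)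
  -- A foot of an altitude divides its side into the pieces `γ / a` and `β / a`.
  have hfoot : ∀ {P Q : E} {p q s : ℝ}, 0 < p → 0 < q → s = p + q →
      P ∈ convexHull ℝ {A, B, C} → Q ∈ convexHull ℝ {A, B, C} →
      P + (p / s) • (Q - P) ∈ convexHull ℝ {A, B, C} := by
    intro P Q p q s hp hq hs hP hQ
    refine (convex_convexHull ℝ _).add_smul_sub_mem hP hQ ⟨by subst hs; positivity, ?_⟩
    rw [div_le_one (by linarith)]; linarith
  have hA : A ∈ convexHull ℝ {A, B, C} := subset_convexHull ℝ _ (by simp)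
  have hB : B ∈ convexHull ℝ {A, B, C} := subset_convexHull ℝ _ (by simp)
  have hC : C ∈ convexHull ℝ {A, B, C} := subset_convexHull ℝ _ (by simp)
  have hsub : ∀ {n P Q : E} (t : ℝ), ⟪n, Q - P⟫ = 0 → ⟪n, P + t • (Q - P)⟫ = ⟪n, P⟫ := by
    intro n P Q t h
    rw [inner_add_right, inner_smul_right, h, mul_zero, add_zero]
  have hne : ∀ {n m p : E}, 0 < ⟪n - m, p⟫ → n ≠ m := by
    rintro n m p h rfl
    simp at h
  have hx : 0 < γ * c / (a * b) := by positivity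
  have hy : 0 < α * a / (b * c) := by positivity
  have hz : 0 < β * b / (c * a) := by positivity
  have hlen : γ * c / (a * b) + α * a / (b * c) + β * b / (c * a) =
      2 * (α * β + β * γ + γ * α) / (a * b * c) := by
    field_simp
    rw [ha2, hb2, hc2]; ring
  rw [← hlen]
  refine billiardLength_le_of_triangle (convex_convexHull ℝ _) (P := B + (β / a ^ 2) • (C - B))
    (Q := C + (γ / b ^ 2) • (A - C)) (R := A + (α / c ^ 2) • (B - A))
    (hfoot hβ hγ ha2 hB hC) (hfoot hγ hα hb2 hC hA)
    (hfoot hα hβ hc2 hA hB)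
    hx hy hz hu hv hw ?_ ?_ ?_ (hne hE1) (hne hF1) (hne hD1) ?_ ?_ ?_
  · have h1 : β / a ^ 2 = 1 - γ / a ^ 2 := by field_simp; linarith
    have h2 : γ * c / (a * b) * (b / (a * c)) = γ / a ^ 2 := by field_simp
    have h3 : γ * c / (a * b) * (a / (b * c)) = γ / b ^ 2 := by field_simp
    simp only [u, smul_add, smul_smul, h2, h3, h1]
    module
  · have h1 : γ / b ^ 2 = 1 - α / b ^ 2 := by field_simp; linarith
    have h2 : α * a / (b * c) * (c / (b * a)) = α / b ^ 2 := by field_simp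
    have h3 : α * a / (b * c) * (b / (c * a)) = α / c ^ 2 := by field_simp
    simp only [v, smul_add, smul_smul, h2, h3, h1]
    module
  · have h1 : α / c ^ 2 = 1 - β / c ^ 2 := by field_simp; linarith
    have h2 : β * b / (c * a) * (a / (c * b)) = β / c ^ 2 := by field_simp
    have h3 : β * b / (c * a) * (c / (a * b)) = β / a ^ 2 := by field_simp
    simp only [w, smul_add, smul_smul, h2, h3, h1]
    module
  · intro p hp
    rw [hsub _ hE0]
    have h1 := hE0; have h2 := hE1
    rw [inner_sub_right] at h1 h2
    exact inner_le_of_mem_convexHull_triple (by linarith) (by linarith) le_rfl hp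
  · intro p hp
    rw [hsub _ hF0]
    have h1 := hF0; have h2 := hF1
    rw [inner_sub_right] at h1 h2
    exact inner_le_of_mem_convexHull_triple le_rfl (by linarith) (by linarith) hp
  · intro p hp
    rw [hsub _ hD0]
    have h1 := hD0; have h2 := hD1
    rw [inner_sub_right] at h1 h2
    exact inner_le_of_mem_convexHull_triple (by linarith) le_rfl (by linarith) hp

/-- The altitude on a side that contains its foot is a double normal of the triangle. -/
lemma billiardLength_triangle_le_altitude {A B C : E} {t : ℝ} (ht0 : 0 ≤ t) (ht1 : t ≤ 1)
    (hne : A ≠ B + t • (C - B)) (horth : ⟪A - (B + t • (C - B)), C - B⟫ = 0) :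
    billiardLength (convexHull ℝ {A, B, C}) ≤
      ENNReal.ofReal (2 * dist (B + t • (C - B)) A) := by
  set D := B + t • (C - B) with hD
  have hA : A ∈ convexHull ℝ {A, B, C} := subset_convexHull ℝ _ (by simp)
  have hB : B ∈ convexHull ℝ {A, B, C} := subset_convexHull ℝ _ (by simp)
  have hC : C ∈ convexHull ℝ {A, B, C} := subset_convexHull ℝ _ (by simp)
  have hDB : ⟪A - D, D⟫ = ⟪A - D, B⟫ := by
    conv_lhs => rw [hD, inner_add_right, inner_smul_right]
    rw [← hD, horth, mul_zero, add_zero]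
  have hBC : ⟪A - D, C⟫ = ⟪A - D, B⟫ := by
    rw [inner_sub_right] at horth; linarith
  have hAD : ⟪A - D, D⟫ ≤ ⟪A - D, A⟫ := by
    have h : 0 ≤ ⟪A - D, A - D⟫ := real_inner_self_nonneg
    rw [inner_sub_right] at h
    linarith
  refine billiardLength_le_of_double_normal (convex_convexHull ℝ _)
    ((convex_convexHull ℝ _).add_smul_sub_mem hB hC ⟨ht0, ht1⟩) hA hne.symm
    (fun x hx => inner_le_of_mem_convexHull_triple le_rfl (by linarith) (by linarith) hx)
    (fun x hx => ?_)
  have := inner_le_of_mem_convexHull_triple (n := -(A - D)) (r := -⟪A - D, D⟫)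
    (by rw [inner_neg_left]; linarith) (by rw [inner_neg_left]; linarith)
    (by rw [inner_neg_left]; linarith) hx
  rw [inner_neg_left] at this
  linarith

lemma convex_dualBody (K : Set E) (z : E) : Convex ℝ (dualBody K z) := by
  have : dualBody K z = ⋂ x ∈ K, {y : E | ⟪x - z, y⟫ ≤ 1} := by ext; simp [dualBody]
  rw [this]
  exact convex_iInter₂ fun x _ => convex_halfSpace_le (innerₛₗ ℝ (x - z)).isLinear 1

lemma mem_dualBody_convexHull {s : Set E} {z y : E} :
    y ∈ dualBody (convexHull ℝ s) z ↔ ∀ x ∈ s, ⟪x - z, y⟫ ≤ 1 := by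
  refine ⟨fun h x hx => h x (subset_convexHull ℝ s hx), fun h x hx => ?_⟩
  have hconv : Convex ℝ {x : E | ⟪y, x⟫ ≤ 1 + ⟪y, z⟫} :=
    convex_halfSpace_le (innerₛₗ ℝ y).isLinear _
  have : ⟪y, x⟫ ≤ 1 + ⟪y, z⟫ := by
    refine convexHull_min (fun p hp => ?_) hconv hx
    have := h p hp
    rw [real_inner_comm, inner_sub_right] at this
    change ⟪y, p⟫ ≤ 1 + ⟪y, z⟫
    linarith
  rw [real_inner_comm, inner_sub_right]
  linarith

/-- The dual of a triangle with respect to the midpoint of a side `BC` of length `a` is bounded by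
two parallel lines at distance `4 / a`. They have a common perpendicular in the dual if the foot of
the altitude from `A` lies on the side `BC`. -/
lemma billiardLength_dualBody_midpoint_le {A B C : E} {a : ℝ} (ha : 0 < a)
    (hXX : ⟪C - B, C - B⟫ = a ^ 2) (hβ : 0 ≤ ⟪A - B, C - B⟫) (hγ : ⟪A - C, C - B⟫ ≤ 0) :
    billiardLength (dualBody (convexHull ℝ {A, B, C}) (midpoint ℝ B C)) ≤
      ENNReal.ofReal (8 / a) := by
  set z := midpoint ℝ B C with hz
  have hBz : B - z = (-(1 / 2) : ℝ) • (C - B) := by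
    rw [hz, midpoint_eq_smul_add, invOf_eq_inv]; module
  have hCz : C - z = (1 / 2 : ℝ) • (C - B) := by
    rw [hz, midpoint_eq_smul_add, invOf_eq_inv]; module
  have hAz : ⟪A - z, C - B⟫ = ⟪A - B, C - B⟫ - a ^ 2 / 2 := by
    have : A - z = (A - B) + (B - z) := by abel
    rw [this, inner_add_left, hBz, inner_smul_left, hXX, conj_trivial]; ring
  have hAC : ⟪A - C, C - B⟫ = ⟪A - B, C - B⟫ - a ^ 2 := by
    have : A - C = (A - B) - (C - B) := by abel
    rw [this, inner_sub_left, hXX]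
  set k := 2 / a ^ 2 with hk
  have hk0 : 0 < k := by positivity
  have hka : k * a ^ 2 = 2 := by rw [hk]; field_simp
  have hmem : ∀ ε : ℝ, |ε| = k → ε • (C - B) ∈ dualBody (convexHull ℝ {A, B, C}) z := by
    intro ε hε
    have h1 : ε * a ^ 2 ≤ 2 ∧ -2 ≤ ε * a ^ 2 := by
      rw [and_comm, ← abs_le, abs_mul, hε, abs_of_pos (pow_pos ha 2), hka]
    rw [mem_dualBody_convexHull]
    rintro x (rfl | rfl | rfl)
    · rw [inner_smul_right, hAz]
      have h2 : |ε * (⟪x - B, C - B⟫ - a ^ 2 / 2)| ≤ 1 := by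
        rw [abs_mul, hε]
        have h3 : |⟪x - B, C - B⟫ - a ^ 2 / 2| ≤ a ^ 2 / 2 := by
          rw [abs_le]; constructor <;> linarith
        calc k * _ ≤ k * (a ^ 2 / 2) := mul_le_mul_of_nonneg_left h3 hk0.le
          _ = 1 := by linarith
      exact (le_abs_self _).trans h2
    · rw [hBz, inner_smul_left, inner_smul_right, hXX, conj_trivial]; linarith
    · rw [hCz, inner_smul_left, inner_smul_right, hXX, conj_trivial]; linarith
  have hdiff : k • (C - B) - (-k) • (C - B) = (2 * k) • (C - B) := by module
  have hnorm : ‖C - B‖ = a := by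
    rw [← sq_eq_sq₀ (norm_nonneg _) ha.le, ← real_inner_self_eq_norm_sq, hXX]
  have hdist : dist ((-k) • (C - B)) (k • (C - B)) = 4 / a := by
    rw [dist_comm, dist_eq_norm, hdiff, norm_smul, hnorm, Real.norm_of_nonneg (by positivity), hk]
    field_simp
    norm_num
  have hbound : ∀ x ∈ dualBody (convexHull ℝ {A, B, C}) z, |⟪C - B, x⟫| ≤ 2 := by
    intro x hx
    rw [mem_dualBody_convexHull] at hx
    have h1 := hx B (by simp)
    have h2 := hx C (by simp)
    rw [hBz, inner_smul_left, conj_trivial] at h1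
    rw [hCz, inner_smul_left, conj_trivial] at h2
    rw [abs_le]; constructor <;> linarith
  refine (billiardLength_le_of_double_normal (convex_dualBody _ z)
    (hmem (-k) (by rw [abs_neg, abs_of_pos hk0])) (hmem k (abs_of_pos hk0)) ?_ ?_ ?_).trans
    (le_of_eq ?_)
  · intro h
    rw [h, dist_self] at hdist
    have : 0 < 4 / a := by positivity
    linarith
  · intro x hx
    rw [hdiff, inner_smul_left, inner_smul_left, inner_smul_right, hXX, conj_trivial, hka]
    exact mul_le_mul_of_nonneg_left (abs_le.1 (hbound x hx)).2 (by positivity)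
  · intro x hx
    rw [hdiff, inner_smul_left, inner_smul_left, inner_smul_right, hXX, conj_trivial, neg_mul, hka]
    exact mul_le_mul_of_nonneg_left (abs_le.1 (hbound x hx)).1 (by positivity)
  · rw [hdist]; congr 1; ring

/-- With `a` the longest side, sixteen times the squared area is at most `3 a² b c`,
with equality only for an equilateral triangle. -/
lemma sixteen_area_sq_le {a b c : ℝ} (hb : 0 < b) (hc : 0 < c) (hba : b ≤ a) (hca : c ≤ a) :
    ((b + c) ^ 2 - a ^ 2) * (a ^ 2 - (b - c) ^ 2) ≤ 3 * a ^ 2 * (b * c) ∧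
      (((b + c) ^ 2 - a ^ 2) * (a ^ 2 - (b - c) ^ 2) = 3 * a ^ 2 * (b * c) → b = a ∧ c = a) := by
  have hkey : b * c ≤ a ^ 2 - (b - c) ^ 2 := by
    rcases le_total b c with h | h <;> nlinarith
  have hbc : 0 < b * c := mul_pos hb hc
  have hid : 3 * a ^ 2 * (b * c) - ((b + c) ^ 2 - a ^ 2) * (a ^ 2 - (b - c) ^ 2) =
      (a ^ 2 - (b - c) ^ 2) * ((a ^ 2 - (b - c) ^ 2) - b * c) + 3 * (b * c) * (b - c) ^ 2 := by
    ring
  have h1 : 0 ≤ (a ^ 2 - (b - c) ^ 2) * ((a ^ 2 - (b - c) ^ 2) - b * c) :=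
    mul_nonneg (hbc.le.trans hkey) (by linarith)
  have h2 : 0 ≤ 3 * (b * c) * (b - c) ^ 2 := by positivity
  refine ⟨by linarith, fun h => ?_⟩
  have h3 : 3 * (b * c) * (b - c) ^ 2 = 0 := by linarith
  have h4 : b = c := by
    rcases mul_eq_zero.1 h3 with h | h
    · linarith
    · exact sub_eq_zero.1 (pow_eq_zero_iff two_ne_zero |>.1 h)
  have h5 : (a ^ 2 - (b - c) ^ 2) * ((a ^ 2 - (b - c) ^ 2) - b * c) = 0 := by linarith
  have h6 : a ^ 2 = b ^ 2 := by
    rcases mul_eq_zero.1 h5 with h | h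
    · linarith
    · subst h4; nlinarith
  have h7 : a = b := (sq_eq_sq₀ (by linarith) hb.le).1 h6
  exact ⟨h7.symm, by rw [h7, h4]⟩

/-- The trajectories in the triangle and in its dual with respect to the midpoint of a longest side
`BC` give the upper bound. -/
lemma billiardProduct_triangle_le {A B C : E} (hnc : ∀ t : ℝ, A ≠ B + t • (C - B)) (hBC : B ≠ C)
    (hb : dist C A ≤ dist B C) (hc : dist A B ≤ dist B C) :
    billiardProduct (convexHull ℝ {A, B, C}) ≤ 12 ∧
      (billiardProduct (convexHull ℝ {A, B, C}) = 12 →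
        dist C A = dist B C ∧ dist A B = dist B C) := by
  have hAB : A ≠ B := by simpa using hnc 0
  have hAC : A ≠ C := by simpa using hnc 1
  have hXX : ⟪C - B, C - B⟫ = dist B C ^ 2 := by
    rw [real_inner_self_eq_norm_sq, dist_eq_norm, norm_sub_rev]
  have hYY : ⟪A - C, A - C⟫ = dist C A ^ 2 := by
    rw [real_inner_self_eq_norm_sq, dist_eq_norm, norm_sub_rev]
  have hZZ : ⟪B - A, B - A⟫ = dist A B ^ 2 := by
    rw [real_inner_self_eq_norm_sq, dist_eq_norm, norm_sub_rev]
  have ha0 := dist_pos.2 hBC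
  have hb0 := dist_pos.2 hAC.symm
  have hc0 := dist_pos.2 hAB
  generalize dist B C = a at *
  generalize dist C A = b at *
  generalize dist A B = c at *
  obtain ⟨γ, hγ⟩ : ∃ γ, ⟪C - B, A - C⟫ = -γ := ⟨_, (neg_neg _).symm⟩
  obtain ⟨α, hα⟩ : ∃ α, ⟪A - C, B - A⟫ = -α := ⟨_, (neg_neg _).symm⟩
  obtain ⟨β, hβ⟩ : ∃ β, ⟪B - A, C - B⟫ = -β := ⟨_, (neg_neg _).symm⟩
  have ha2 : a ^ 2 = β + γ := by
    have : C - B = -(A - C) - (B - A) := by abel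
    rw [← hXX]
    nth_rewrite 2 [this]
    rw [inner_sub_right, inner_neg_right, hγ, real_inner_comm, hβ]; ring
  have hb2 : b ^ 2 = γ + α := by
    have : A - C = -(C - B) - (B - A) := by abel
    rw [← hYY]
    nth_rewrite 2 [this]
    rw [inner_sub_right, inner_neg_right, hα, real_inner_comm, hγ]; ring
  have hc2 : c ^ 2 = α + β := by
    have : B - A = -(A - C) - (C - B) := by abel
    rw [← hZZ]
    nth_rewrite 2 [this]
    rw [inner_sub_right, inner_neg_right, hβ, real_inner_comm, hα]; ring
  have hba : b ^ 2 ≤ a ^ 2 := pow_le_pow_left₀ hb0.le hb 2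
  have hca : c ^ 2 ≤ a ^ 2 := pow_le_pow_left₀ hc0.le hc 2
  have hβ0 : 0 < β := by nlinarith
  have hγ0 : 0 < γ := by nlinarith
  have hβ' : ⟪A - B, C - B⟫ = β := by
    rw [← neg_sub B A, inner_neg_left, hβ, neg_neg]
  have hγ' : ⟪A - C, C - B⟫ = -γ := by rw [real_inner_comm, hγ]
  have hdual := billiardLength_dualBody_midpoint_le (A := A) ha0 hXX (by linarith) (by linarith)
  have hle : ∀ L : ℝ, 0 ≤ L → billiardLength (convexHull ℝ {A, B, C}) ≤ ENNReal.ofReal L →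
      billiardProduct (convexHull ℝ {A, B, C}) ≤ ENNReal.ofReal (L * (8 / a)) := by
    intro L hL h
    rw [ENNReal.ofReal_mul hL]
    exact (iInf_le _ (midpoint ℝ B C)).trans (mul_le_mul' h hdual)
  have h12 : (12 : ℝ≥0∞) = ENNReal.ofReal 12 := by simp
  -- The angle at `A` is acute exactly if `α > 0`; the other two angles are always acute.
  rcases le_or_gt α 0 with hα0 | hα0
  · set t := β / a ^ 2 with ht
    have ht0 : 0 ≤ t := by positivity
    have ht1 : t ≤ 1 := by rw [ht, div_le_one (by positivity)]; linarith
    have hta : t * a ^ 2 = β := by rw [ht]; field_simp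
    have horth : ⟪A - (B + t • (C - B)), C - B⟫ = 0 := by
      rw [← sub_sub, inner_sub_left, inner_smul_left, hβ', hXX, conj_trivial, hta, sub_self]
    have halt := billiardLength_triangle_le_altitude ht0 ht1 (hnc t) horth
    have hh : dist (B + t • (C - B)) A ≤ a / 2 := by
      rw [dist_comm, dist_eq_norm]
      refine le_of_sq_le_sq ?_ (by positivity)
      rw [← real_inner_self_eq_norm_sq]
      have : ⟪A - (B + t • (C - B)), A - (B + t • (C - B))⟫ = c ^ 2 - t * β := by
        conv_lhs => rw [← sub_sub, inner_sub_right, inner_smul_right, sub_sub, horth, ← sub_sub,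
          inner_sub_left, inner_smul_left, real_inner_comm (A - B) (C - B), hβ', ← neg_sub B A,
          inner_neg_neg, hZZ, conj_trivial, mul_zero, sub_zero]
      nlinarith [mul_nonneg (sq_nonneg (2 * t - 1)) (sq_nonneg a)]
    have hlt : billiardProduct (convexHull ℝ {A, B, C}) < 12 := by
      refine (hle _ (by positivity) halt).trans_lt ?_
      rw [h12, ENNReal.ofReal_lt_ofReal_iff (by norm_num)]
      calc 2 * dist (B + t • (C - B)) A * (8 / a) ≤ 2 * (a / 2) * (8 / a) := by gcongr
        _ = 8 := by field_simp
        _ < 12 := by norm_num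
    exact ⟨hlt.le, fun h => absurd h hlt.ne⟩
  · have horth := billiardLength_triangle_le_orthic ha0 hb0 hc0 hα0 hβ0 hγ0 hXX hYY hZZ hγ hα hβ
      ha2 hb2 hc2
    have hprod := hle _ (by positivity) horth
    obtain ⟨h1, h2⟩ := sixteen_area_sq_le hb0 hc0 hb hc
    have hid : ((b + c) ^ 2 - a ^ 2) * (a ^ 2 - (b - c) ^ 2) =
        4 * (α * β + β * γ + γ * α) := by
      have : ((b + c) ^ 2 - a ^ 2) * (a ^ 2 - (b - c) ^ 2) =
          2 * (a ^ 2 * b ^ 2 + b ^ 2 * c ^ 2 + c ^ 2 * a ^ 2) -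
            ((a ^ 2) ^ 2 + (b ^ 2) ^ 2 + (c ^ 2) ^ 2) := by ring
      rw [this, ha2, hb2, hc2]; ring
    rw [hid] at h1 h2
    have hval : 2 * (α * β + β * γ + γ * α) / (a * b * c) * (8 / a) =
        12 * (4 * (α * β + β * γ + γ * α) / (3 * a ^ 2 * (b * c))) := by
      field_simp; ring
    have hpos : 0 < 3 * a ^ 2 * (b * c) := by positivity
    rw [hval] at hprod
    refine ⟨hprod.trans ?_, fun h => h2 (h1.antisymm ?_)⟩
    · rw [h12]
      refine ENNReal.ofReal_le_ofReal ?_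
      have := (div_le_one hpos).2 h1
      linarith
    · rw [h, h12, ENNReal.ofReal_le_ofReal_iff (by positivity)] at hprod
      exact (one_le_div hpos).1 (by linarith)

end Triangles

/-! ### Lower bounds for the length of a trajectory -/

section LowerBound

variable {E : Type*} [NormedAddCommGroup E] [InnerProductSpace ℝ E]

/-- A billiard trajectory of `K` cannot be moved into the interior of `K` by a translation: it
presses against `K` in directions that balance out. -/
lemma IsClosedBilliardTrajectory.exists_not_translate {K : Set E} {m : ℕ} [NeZero m]
    {q : Fin m → E} (hq : IsClosedBilliardTrajectory K q) (t : E) :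
    ∃ i, q i + t ∉ interior K := by
  by_contra! hint
  choose n hn hrefl using hq.reflects
  set u : Fin m → E := fun i => unitDir (q (i + 1) - q i) with hu
  have hrefl' : ∀ i, u (i + 1) = u i - (2 * ⟪n i, u i⟫) • n i := hrefl
  have hpos : ∀ i, 0 < ⟪n i, u i⟫ := by
    intro i
    have h0 : 0 ≤ ⟪n i, u i⟫ := by
      have h := (hn i).2.2 (q i) (hq.segment_subset i (left_mem_segment ℝ _ _))
      simp only [hu, unitDir, inner_smul_right, inner_sub_right]
      exact mul_nonneg (by simp) (by linarith)
    refine lt_of_le_of_ne h0 fun h => hq.turns i ?_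
    have := hrefl' i
    rw [← h] at this
    simpa using this
  have hneg : ∀ i, ⟪n i, t⟫ < 0 := by
    intro i
    have hcont : Filter.Tendsto (fun ε : ℝ => q (i + 1) + t + ε • n i)
        (nhdsWithin 0 (Set.Ioi 0)) (nhds (q (i + 1) + t)) := by
      have : Continuous (fun ε : ℝ => q (i + 1) + t + ε • n i) := by fun_prop
      have h := this.tendsto 0
      simp only [zero_smul, add_zero] at h
      exact h.mono_left nhdsWithin_le_nhds
    obtain ⟨ε, hεK, hε⟩ := ((hcont.eventually (mem_interior_iff_mem_nhds.1 (hint (i + 1)))).and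
      self_mem_nhdsWithin).exists
    have h := (hn i).2.2 _ hεK
    rw [inner_add_right, inner_add_right, inner_smul_right, real_inner_self_eq_norm_sq,
      (hn i).2.1] at h
    have : (0 : ℝ) < ε := hε
    linarith
  have hshift : ∑ i, ⟪u (i + 1), t⟫ = ∑ i, ⟪u i, t⟫ :=
    Equiv.sum_comp (Equiv.addRight (1 : Fin m)) fun i => ⟪u i, t⟫
  have hsum : ∑ i, 2 * ⟪n i, u i⟫ * ⟪n i, t⟫ = 0 := by
    have : ∀ i, 2 * ⟪n i, u i⟫ * ⟪n i, t⟫ = ⟪u i, t⟫ - ⟪u (i + 1), t⟫ := by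
      intro i
      rw [hrefl', inner_sub_left, inner_smul_left, conj_trivial]; ring
    simp_rw [this, Finset.sum_sub_distrib, hshift, sub_self]
  refine (Finset.sum_neg (fun i _ => ?_) Finset.univ_nonempty).ne hsum
  exact mul_neg_of_pos_of_neg (mul_pos two_pos (hpos i)) (hneg i)

/-- Gordan's alternative: if the system `⟪w i, t⟫ < δ i` has no solution `t`, then there is a
convex combination of the inequalities whose left side vanishes and whose right side is not
positive. -/
lemma exists_convex_combination_of_infeasible {ι : Type*} [Fintype ι] [Nonempty ι] (w : ι → E)
    (δ : ι → ℝ) (h : ¬ ∃ t : E, ∀ i, ⟪w i, t⟫ < δ i) :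
    ∃ l : ι → ℝ, (∀ i, 0 ≤ l i) ∧ ∑ i, l i = 1 ∧ ∑ i, l i • w i = 0 ∧ ∑ i, l i * δ i ≤ 0 := by
  classical
  set S : Set (ι → ℝ) := {x | ∃ t : E, ∀ i, ⟪w i, t⟫ < x i} with hS
  have hconv : Convex ℝ S := by
    rintro x ⟨t, ht⟩ y ⟨s, hs⟩ a b ha hb hab
    refine ⟨a • t + b • s, fun i => ?_⟩
    rw [inner_add_right, inner_smul_right, inner_smul_right]
    change _ < a * x i + b * y i
    rcases ha.eq_or_lt with rfl | ha
    · obtain rfl : b = 1 := by linarith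
      linarith [hs i]
    · have h1 := mul_lt_mul_of_pos_left (ht i) ha
      have h2 := mul_le_mul_of_nonneg_left (hs i).le hb
      linarith
  have hopen : IsOpen S := by
    have : S = ⋃ t : E, ⋂ i, {x : ι → ℝ | ⟪w i, t⟫ < x i} := by ext; simp [hS]
    rw [this]
    exact isOpen_iUnion fun t => isOpen_iInter_of_finite fun i =>
      isOpen_lt continuous_const (continuous_apply i)
  obtain ⟨f, hf⟩ := geometric_hahn_banach_open_point hconv hopen h
  have hfsum : ∀ x : ι → ℝ, f x = ∑ i, x i * f (Pi.single i 1) := by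
    intro x
    conv_lhs => rw [pi_eq_sum_univ' x]
    simp [map_sum]
  set g : ι → ℝ := fun i => f (Pi.single i 1) with hg
  -- A linear function of `M` that is bounded above for all `M ≥ 0` has slope at most zero.
  have hslope : ∀ a b c : ℝ, (∀ M : ℝ, 0 ≤ M → M * a + b < c) → a ≤ 0 := by
    intro a b c hM
    by_contra! ha
    have h0 := hM 0 le_rfl
    have := hM ((c - b) / a) (div_nonneg (by linarith) ha.le)
    rw [div_mul_cancel₀ _ ha.ne'] at this
    linarith
  have hmem : ∀ (t : E) (M : ℝ) (ε : ι → ℝ), (∀ i, 0 < ε i) →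
      (fun i => M * ⟪w i, t⟫ + ε i) ∈ S := by
    intro t M ε hε
    exact ⟨M • t, fun i => by rw [inner_smul_right]; linarith [hε i]⟩
  have hg0 : ∀ i, g i ≤ 0 := by
    intro i
    refine hslope (g i) (∑ j, g j) (f δ) fun M hM => ?_
    have h1 := hf _ (hmem 0 0 (fun j => 1 + if j = i then M else 0) fun j => by
      split_ifs <;> linarith)
    rw [hfsum] at h1
    refine lt_of_eq_of_lt ?_ h1
    simp [add_mul, Finset.sum_add_distrib, ite_mul, hg]
    ring
  have hgw : ∀ t : E, ∑ i, g i * ⟪w i, t⟫ ≤ 0 := by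
    intro t
    refine hslope _ (∑ j, g j) (f δ) fun M _ => ?_
    have h1 := hf _ (hmem t M (fun _ => 1) fun _ => one_pos)
    rw [hfsum] at h1
    refine lt_of_eq_of_lt ?_ h1
    rw [Finset.mul_sum, ← Finset.sum_add_distrib]
    exact Finset.sum_congr rfl fun i _ => by ring
  have hgw0 : ∑ i, g i • w i = 0 := by
    have h1 := hgw (∑ i, g i • w i)
    have h2 : ∑ i, g i * ⟪w i, ∑ j, g j • w j⟫ = ⟪∑ i, g i • w i, ∑ j, g j • w j⟫ := by
      rw [sum_inner]
      exact Finset.sum_congr rfl fun i _ => by rw [inner_smul_left, conj_trivial]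
    rw [h2] at h1
    exact inner_self_eq_zero.1 (le_antisymm h1 real_inner_self_nonneg)
  have hgδ : 0 ≤ ∑ i, g i * δ i := by
    have h1 : ∀ ε : ℝ, 0 < ε → ε * ∑ i, g i < ∑ i, g i * δ i := by
      intro ε hε
      have h1 := hf _ (hmem 0 0 (fun _ => ε) fun _ => hε)
      rw [hfsum, hfsum δ] at h1
      refine lt_of_eq_of_lt ?_ (h1.trans_eq (Finset.sum_congr rfl fun i _ => mul_comm _ _))
      simp [Finset.mul_sum, hg]
    by_contra! hneg
    have hG : ∑ i, g i < 0 := by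
      have := h1 1 one_pos
      linarith
    have h2 := h1 ((∑ i, g i * δ i) / ∑ i, g i) (div_pos_of_neg_of_neg hneg hG)
    rw [div_mul_cancel₀ _ hG.ne] at h2
    exact lt_irrefl _ h2
  have hG : ∑ i, g i < 0 := by
    refine lt_of_le_of_ne (Finset.sum_nonpos fun i _ => hg0 i) fun h0 => ?_
    have hz : ∀ i, g i = 0 := fun i =>
      (Finset.sum_eq_zero_iff_of_nonpos fun j _ => hg0 j).1 h0 i (Finset.mem_univ i)
    have h1 := hf _ (hmem 0 0 (fun _ => 1) fun _ => one_pos)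
    rw [hfsum, hfsum δ] at h1
    change ∑ i, _ * g i < ∑ i, δ i * g i at h1
    simp [hz] at h1
  refine ⟨fun i => g i / ∑ j, g j, fun i => div_nonneg_of_nonpos (hg0 i) hG.le, ?_, ?_, ?_⟩
  · rw [← Finset.sum_div, div_self hG.ne]
  · simp_rw [div_eq_inv_mul, mul_smul, ← Finset.smul_sum, hgw0, smul_zero]
  · simp_rw [div_mul_eq_mul_div, ← Finset.sum_div]
    exact div_nonpos_of_nonneg_of_nonpos hgδ hG.le

/-- A closed polygon is at least as long as the triangle formed by any three of its vertices. -/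
lemma triangle_perimeter_le_closedLength {m : ℕ} [NeZero m] (q : Fin m → E) (i j k : Fin m) :
    dist (q i) (q j) + dist (q j) (q k) + dist (q k) (q i) ≤ closedLength q := by
  set f : ℕ → E := fun n => q (Fin.ofNat m n) with hf
  have hfval : ∀ i : Fin m, f i = q i := fun i => by simp [hf]
  have hlen : closedLength q = ∑ n ∈ Finset.range m, dist (f n) (f (n + 1)) := by
    rw [closedLength, ← Fin.sum_univ_eq_sum_range fun n => dist (f n) (f (n + 1))]
    refine Finset.sum_congr rfl fun i _ => ?_
    have : f (i + 1) = q (i + 1) := by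
      simp only [hf]
      congr 1
      ext
      simp [Fin.val_add]
    rw [this, hfval]
  have hwrap : f m = f 0 := by
    simp only [hf]
    congr 1
    ext
    simp
  have key : ∀ a b c : ℕ, a ≤ b → b ≤ c → c ≤ m →
      dist (f a) (f b) + dist (f b) (f c) + dist (f c) (f a) ≤ closedLength q := by
    intro a b c hab hbc hcm
    have h1 := dist_le_Ico_sum_dist f hab
    have h2 := dist_le_Ico_sum_dist f hbc
    have h3 := dist_le_Ico_sum_dist f hcm
    have h4 := dist_le_Ico_sum_dist f (Nat.zero_le a)
    have h5 := dist_triangle (f c) (f 0) (f a)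
    rw [hwrap] at h3
    rw [hlen, Finset.range_eq_Ico, ← Finset.sum_Ico_consecutive _ (Nat.zero_le a)
      (hab.trans (hbc.trans hcm)), ← Finset.sum_Ico_consecutive _ hab (hbc.trans hcm),
      ← Finset.sum_Ico_consecutive _ hbc hcm]
    linarith
  rw [← hfval i, ← hfval j, ← hfval k]
  have hi := i.2.le
  have hj := j.2.le
  have hk := k.2.le
  generalize (i : ℕ) = a at *
  generalize (j : ℕ) = b at *
  generalize (k : ℕ) = c at *
  have e1 := dist_comm (f a) (f b)
  have e2 := dist_comm (f b) (f c)
  have e3 := dist_comm (f c) (f a)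
  rcases le_total a b with h1 | h1 <;> rcases le_total b c with h2 | h2 <;>
    rcases le_total a c with h3 | h3
  · linarith [key a b c h1 h2 hk]
  · linarith [key a b c h1 h2 hk]
  · linarith [key a c b h3 h2 hj]
  · linarith [key c a b h3 h1 hj]
  · linarith [key b a c h1 h3 hk]
  · linarith [key b c a h2 h3 hi]
  · linarith [key c b a h2 h1 hi]
  · linarith [key c b a h2 h1 hi]

/-- If `K` contains the polygon `{y | ∀ i, ⟪w i, y⟫ ≤ b i}`, then every billiard
trajectory of `K` has a vertex `p i` for each `i` such that some convex combination of the `w i`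
vanishes and the same combination of the `⟪w i, p i⟫` is at least that of the `b i`. -/
lemma IsClosedBilliardTrajectory.exists_vertices {ι : Type*} [Fintype ι] [Nonempty ι]
    {K : Set E} {m : ℕ} [NeZero m] {q : Fin m → E} (hq : IsClosedBilliardTrajectory K q)
    {w : ι → E} {b : ι → ℝ} (hK : {y : E | ∀ i, ⟪w i, y⟫ ≤ b i} ⊆ K) :
    ∃ (j : ι → Fin m) (l : ι → ℝ), (∀ i, 0 ≤ l i) ∧ ∑ i, l i = 1 ∧ ∑ i, l i • w i = 0 ∧
      ∑ i, l i * b i ≤ ∑ i, l i * ⟪w i, q (j i)⟫ := by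
  have hmax : ∀ i, ∃ j, ∀ k, ⟪w i, q k⟫ ≤ ⟪w i, q j⟫ := fun i => Finite.exists_max _
  choose j hj using hmax
  have hinf : ¬ ∃ t : E, ∀ i, ⟪w i, t⟫ < b i - ⟪w i, q (j i)⟫ := by
    rintro ⟨t, ht⟩
    obtain ⟨k, hk⟩ := hq.exists_not_translate t
    refine hk (interior_maximal (s := K) (t := {y : E | ∀ i, ⟪w i, y⟫ < b i})
      (fun y hy => hK fun i => (hy i).le) ?_ fun i => ?_)
    · have : {y : E | ∀ i, ⟪w i, y⟫ < b i} = ⋂ i, {y : E | ⟪w i, y⟫ < b i} := by ext; simp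
      rw [this]
      exact isOpen_iInter_of_finite fun i =>
        isOpen_lt (continuous_const.inner continuous_id) continuous_const
    · rw [inner_add_right]
      linarith [hj i k, ht i]
  obtain ⟨l, hl0, hl1, hlw, hlδ⟩ := exists_convex_combination_of_infeasible w _ hinf
  refine ⟨j, l, hl0, hl1, hlw, ?_⟩
  simp_rw [mul_sub, Finset.sum_sub_distrib] at hlδ
  linarith

/-- For an equilateral triangle of side `s` and barycentric coordinates `x, y, z`, the points
`x y (v₀ - v₁)`, `y z (v₁ - v₂)` and `z x (v₂ - v₀)` lie on a circle with centre `c`. -/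
lemma exists_circumcircle {a b : E} {s x y z : ℝ} (ha : ⟪a, a⟫ = s ^ 2) (hb : ⟪b, b⟫ = s ^ 2)
    (hab : ⟪a, b⟫ = -s ^ 2 / 2) (hsum : x + y + z = 1) :
    ∃ c : E, ‖(x * y) • a - c‖ ^ 2 =
        s ^ 2 * ((x * y + y * z + z * x) ^ 2 * (1 - (x * y + y * z + z * x)) - x * y * z) / 3 ∧
      ‖(y * z) • b - c‖ ^ 2 =
        s ^ 2 * ((x * y + y * z + z * x) ^ 2 * (1 - (x * y + y * z + z * x)) - x * y * z) / 3 ∧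
      ‖-(z * x) • (a + b) - c‖ ^ 2 =
        s ^ 2 * ((x * y + y * z + z * x) ^ 2 * (1 - (x * y + y * z + z * x)) - x * y * z) / 3 := by
  have hnorm : ∀ μ ν : ℝ, ‖μ • a + ν • b‖ ^ 2 = s ^ 2 * (μ ^ 2 + ν ^ 2 - μ * ν) := by
    intro μ ν
    rw [← real_inner_self_eq_norm_sq]
    simp only [inner_add_left, inner_add_right, inner_smul_left, inner_smul_right, conj_trivial,
      ha, hb, hab, real_inner_comm a b]
    ring
  obtain rfl : z = 1 - x - y := by linarith
  set z := 1 - x - y with hz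
  set Q := x * y + y * z + z * x with hQ
  -- The numbers `X, Y` and `-(X + Y) = z x - Q y` are the inner products of the centre with `a, b` and
  -- `-(a + b)`, in units of `s² / 2`. They are `r - k / r` for the three points at distance `s r`
  -- from the origin, where the power of the origin is `-k s²`; `k = Q x y z` makes their sum vanish.
  set X := x * y - Q * z with hX
  set Y := y * z - Q * x with hY
  refine ⟨((2 * X + Y) / 3) • a + ((X + 2 * Y) / 3) • b, ?_, ?_, ?_⟩
  · have : (x * y) • a - (((2 * X + Y) / 3) • a + ((X + 2 * Y) / 3) • b) =
      (x * y - (2 * X + Y) / 3) • a + (-((X + 2 * Y) / 3)) • b := by module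
    rw [this, hnorm, hX, hY, hQ, hz]; ring
  · have : (y * z) • b - (((2 * X + Y) / 3) • a + ((X + 2 * Y) / 3) • b) =
      (-((2 * X + Y) / 3)) • a + (y * z - (X + 2 * Y) / 3) • b := by module
    rw [this, hnorm, hX, hY, hQ, hz]; ring
  · have : -(z * x) • (a + b) - (((2 * X + Y) / 3) • a + ((X + 2 * Y) / 3) • b) =
      (-(z * x) - (2 * X + Y) / 3) • a + (-(z * x) - (X + 2 * Y) / 3) • b := by module
    rw [this, hnorm, hX, hY, hQ, hz]; ring

/-- The squared circumradius of `exists_circumcircle` (for `s = 1`) is at most `1 / 64`, with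
equality at the midpoints of the sides. -/
lemma circumradius_sq_le {x y z : ℝ} (hx : 0 ≤ x) (hy : 0 ≤ y) (hz : 0 ≤ z)
    (hsum : x + y + z = 1) :
    ((x * y + y * z + z * x) ^ 2 * (1 - (x * y + y * z + z * x)) - x * y * z) / 3 ≤ 1 / 64 := by
  have hp : 0 ≤ x * y * z := by positivity
  -- Schur's inequality
  have hschur : 4 * (x * y + y * z + z * x) - 1 ≤ 9 * (x * y * z) := by
    have h : 0 ≤ x * (x - y) * (x - z) + y * (y - x) * (y - z) + z * (z - x) * (z - y) := by
      rcases le_total x y with h1 | h1 <;> rcases le_total y z with h2 | h2 <;>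
        rcases le_total x z with h3 | h3 <;>
        nlinarith [mul_nonneg (sub_nonneg.2 h1) (sub_nonneg.2 h2),
          mul_nonneg (sub_nonneg.2 h1) (sub_nonneg.2 h3),
          mul_nonneg (sub_nonneg.2 h2) (sub_nonneg.2 h3),
          mul_nonneg hx (mul_nonneg (sub_nonneg.2 h1) (sub_nonneg.2 h3)),
          mul_nonneg hy (mul_nonneg (sub_nonneg.2 h1) (sub_nonneg.2 h2)),
          mul_nonneg hz (mul_nonneg (sub_nonneg.2 h2) (sub_nonneg.2 h3)),
          mul_nonneg hx (sq_nonneg (x - y)), mul_nonneg hy (sq_nonneg (x - y)),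
          mul_nonneg hz (sq_nonneg (x - y)), mul_nonneg hx (sq_nonneg (x - z)),
          mul_nonneg hy (sq_nonneg (y - z)), mul_nonneg hz (sq_nonneg (y - z))]
    obtain rfl : z = 1 - x - y := by linarith
    nlinarith [h]
  have hq : x * y + y * z + z * x ≤ 1 / 3 := by
    nlinarith [sq_nonneg (x - y), sq_nonneg (y - z), sq_nonneg (z - x)]
  have hq0 : 0 ≤ x * y + y * z + z * x := by positivity
  generalize x * y + y * z + z * x = Q at *
  generalize x * y * z = p at *
  rcases le_total Q (1 / 4) with h | h
  · nlinarith [mul_nonneg hq0 (sub_nonneg.2 h), mul_nonneg (mul_nonneg hq0 hq0) (sub_nonneg.2 h)]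
  · nlinarith [mul_nonneg (sub_nonneg.2 h) (sub_nonneg.2 hq),
      mul_nonneg (sub_nonneg.2 h) (mul_nonneg (sub_nonneg.2 h) (sub_nonneg.2 hq))]

/-- If the edge vectors `e₀ - e₂`, `e₁ - e₀`, `e₂ - e₁` of a triangle are paired with the vertices
of another triangle, the sum of the inner products is at most the perimeter of the latter times the
radius of a circle around the former. -/
lemma sum_inner_edges_le {e₀ e₁ e₂ c p₀ p₁ p₂ : E} {R : ℝ} (h₀ : ‖e₀ - c‖ ≤ R)
    (h₁ : ‖e₁ - c‖ ≤ R) (h₂ : ‖e₂ - c‖ ≤ R) :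
    ⟪e₀ - e₂, p₀⟫ + ⟪e₁ - e₀, p₁⟫ + ⟪e₂ - e₁, p₂⟫ ≤
      R * (dist p₀ p₁ + dist p₁ p₂ + dist p₂ p₀) := by
  have key : ∀ {e p p' : E}, ‖e - c‖ ≤ R → ⟪e - c, p - p'⟫ ≤ R * dist p p' := by
    intro e p p' he
    rw [dist_eq_norm]
    exact (real_inner_le_norm _ _).trans (mul_le_mul_of_nonneg_right he (norm_nonneg _))
  have hid : ⟪e₀ - e₂, p₀⟫ + ⟪e₁ - e₀, p₁⟫ + ⟪e₂ - e₁, p₂⟫ =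
      ⟪e₀ - c, p₀ - p₁⟫ + ⟪e₁ - c, p₁ - p₂⟫ + ⟪e₂ - c, p₂ - p₀⟫ := by
    simp only [inner_sub_left, inner_sub_right]; ring
  rw [hid]
  linarith [key (p := p₀) (p' := p₁) h₀, key (p := p₁) (p' := p₂) h₁, key (p := p₂) (p' := p₀) h₂]

end LowerBound

/-! ### Equilateral triangles -/

section Equilateral

variable {E : Type*} [NormedAddCommGroup E] [InnerProductSpace ℝ E]

/-- The inner products of the edge vectors `v₀ - v₁` and `v₁ - v₂` of an equilateral triangle. -/
lemma inner_edges_of_equilateral {v : Fin 3 → E} {s : ℝ}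
    (hv : ∀ i j, i ≠ j → dist (v i) (v j) = s) :
    ⟪v 0 - v 1, v 0 - v 1⟫ = s ^ 2 ∧ ⟪v 1 - v 2, v 1 - v 2⟫ = s ^ 2 ∧
      ⟪v 0 - v 1, v 1 - v 2⟫ = -s ^ 2 / 2 := by
  have h : ∀ i j, i ≠ j → ⟪v i - v j, v i - v j⟫ = s ^ 2 := fun i j hij => by
    rw [real_inner_self_eq_norm_sq, ← dist_eq_norm, hv i j hij]
  have h02 := h 0 2 (by decide)
  have h01 := h 0 1 (by decide)
  have h12 := h 1 2 (by decide)
  refine ⟨h01, h12, ?_⟩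
  have : v 0 - v 2 = (v 0 - v 1) + (v 1 - v 2) := by abel
  rw [this, real_inner_add_add_self, h01, h12] at h02
  linarith

/-- With barycentric coordinates `l i` of `z` as weights, the vectors `l i • (v i - z)` are the edges
of a triangle whose circumradius is bounded by `R`. -/
lemma sum_inner_le_of_equilateral {v : Fin 3 → E} {z : E} {s R : ℝ} {l : Fin 3 → ℝ}
    (hv : ∀ i j, i ≠ j → dist (v i) (v j) = s) (hl1 : ∑ i, l i = 1)
    (hlz : ∑ i, l i • (v i - z) = 0) (hR : 0 ≤ R)
    (hRl : s ^ 2 * (((l 0 * l 1 + l 1 * l 2 + l 2 * l 0) ^ 2 *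
      (1 - (l 0 * l 1 + l 1 * l 2 + l 2 * l 0)) - l 0 * l 1 * l 2) / 3) ≤ R ^ 2)
    (p : Fin 3 → E) :
    ∑ i, l i * ⟪v i - z, p i⟫ ≤
      R * (dist (p 0) (p 1) + dist (p 1) (p 2) + dist (p 2) (p 0)) := by
  obtain ⟨ha, hb, hab⟩ := inner_edges_of_equilateral hv
  rw [Fin.sum_univ_three] at hl1 hlz
  obtain ⟨c, h0, h1, h2⟩ := exists_circumcircle ha hb hab hl1
  rw [mul_div_assoc] at h0 h1 h2
  have hz : z = l 0 • v 0 + l 1 • v 1 + l 2 • v 2 := by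
    have h : z = (l 0 + l 1 + l 2) • z := by rw [hl1, one_smul]
    rw [h, ← sub_eq_zero, ← neg_eq_zero, ← hlz]
    module
  have hl0 : l 0 = 1 - l 1 - l 2 := by linarith
  have hg0 : l 0 • (v 0 - z) = (l 0 * l 1) • (v 0 - v 1) -
      -(l 2 * l 0) • (v 0 - v 1 + (v 1 - v 2)) := by
    rw [hz, hl0]; module
  have hg1 : l 1 • (v 1 - z) = (l 1 * l 2) • (v 1 - v 2) - (l 0 * l 1) • (v 0 - v 1) := by
    rw [hz, hl0]; module
  have hg2 : l 2 • (v 2 - z) = -(l 2 * l 0) • (v 0 - v 1 + (v 1 - v 2)) -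
      (l 1 * l 2) • (v 1 - v 2) := by
    rw [hz, hl0]; module
  have hin : ∀ i, l i * ⟪v i - z, p i⟫ = ⟪l i • (v i - z), p i⟫ := fun i => by
    rw [inner_smul_left, conj_trivial]
  rw [Fin.sum_univ_three, hin, hin, hin, hg0, hg1, hg2]
  exact sum_inner_edges_le (le_of_sq_le_sq (h0.trans_le hRl) hR)
    (le_of_sq_le_sq (h1.trans_le hRl) hR) (le_of_sq_le_sq (h2.trans_le hRl) hR)

/-- Every trajectory of every dual of an equilateral triangle of side `s` has length at least
`8 / s`. The dual may be unbounded: `z` need not lie inside the triangle. -/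
lemma le_billiardLength_dualBody_of_equilateral {v : Fin 3 → E} {s : ℝ} (hs : 0 < s)
    (hv : ∀ i j, i ≠ j → dist (v i) (v j) = s) (z : E) :
    ENNReal.ofReal (8 / s) ≤ billiardLength (dualBody (convexHull ℝ (Set.range v)) z) := by
  refine le_iInf fun m => le_iInf fun hm => le_iInf fun q => le_iInf fun hq =>
    ENNReal.ofReal_le_ofReal ?_
  obtain ⟨j, l, hl0, hl1, hlw, hlb⟩ := hq.exists_vertices (w := fun i => v i - z)
    (b := fun _ => 1) fun y hy => by
      rw [mem_dualBody_convexHull]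
      rintro _ ⟨i, rfl⟩
      exact hy i
  have hsum := hl1
  rw [Fin.sum_univ_three] at hsum
  have hR := mul_le_mul_of_nonneg_left
    (circumradius_sq_le (hl0 0) (hl0 1) (hl0 2) hsum) (sq_nonneg s)
  have h1 := sum_inner_le_of_equilateral hv hl1 hlw (R := s / 8) (by positivity)
    (hR.trans (by linarith [show (s / 8) ^ 2 = s ^ 2 * (1 / 64) by ring])) fun i => q (j i)
  have h2 := mul_le_mul_of_nonneg_left (triangle_perimeter_le_closedLength q (j 0) (j 1) (j 2))
    (show 0 ≤ s / 8 by positivity)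
  simp only [mul_one, hl1] at hlb
  rw [div_le_iff₀ hs]
  linarith

/-- Every trajectory of an equilateral triangle of side `s` in a plane has length at least
`3 s / 2`. -/
lemma le_billiardLength_of_equilateral {v : Fin 3 → E} {s : ℝ} (hs : 0 < s)
    (hv : ∀ i j, i ≠ j → dist (v i) (v j) = s) (htop : affineSpan ℝ (Set.range v) = ⊤) :
    ENNReal.ofReal (3 * s / 2) ≤ billiardLength (convexHull ℝ (Set.range v)) := by
  obtain ⟨ha, hb, hab⟩ := inner_edges_of_equilateral hv
  have hba : ⟪v 1 - v 2, v 0 - v 1⟫ = -s ^ 2 / 2 := by rw [real_inner_comm, hab]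
  set c : E := (1 / 3 : ℝ) • (v 0 + v 1 + v 2) with hc
  have h0 : v 0 - c = (2 / 3 : ℝ) • (v 0 - v 1) + (1 / 3 : ℝ) • (v 1 - v 2) := by
    rw [hc]; module
  have h1 : v 1 - c = (-1 / 3 : ℝ) • (v 0 - v 1) + (1 / 3 : ℝ) • (v 1 - v 2) := by
    rw [hc]; module
  have h2 : v 2 - c = (-1 / 3 : ℝ) • (v 0 - v 1) + (-2 / 3 : ℝ) • (v 1 - v 2) := by
    rw [hc]; module
  have hgram : ∀ i j, ⟪v i - c, v j - c⟫ = if i = j then s ^ 2 / 3 else -s ^ 2 / 6 := by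
    intro i j
    fin_cases i <;> fin_cases j <;>
      simp only [Fin.zero_eta, Fin.mk_one, Fin.reduceFinMk, h0, h1, h2, inner_add_left,
        inner_add_right, inner_smul_left, inner_smul_right, conj_trivial, ha, hb, hab, hba] <;>
      simp only [Fin.reduceEq, reduceIte, Fin.isValue, zero_ne_one, one_ne_zero] <;> ring
  have hcomb : ∀ (i : Fin 3) (l : Fin 3 → ℝ), ∑ j, l j = 1 →
      ⟪v i - c, ∑ j, l j • (v j - c)⟫ = (l i - 1 / 3) * (s ^ 2 / 2) := by
    intro i l hl
    simp_rw [inner_sum, inner_smul_right, hgram]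
    rw [Fin.sum_univ_three] at hl ⊢
    have : l 0 = 1 - l 1 - l 2 := by linarith
    fin_cases i <;> simp [this] <;> ring
  have hs2 : 0 < s ^ 2 / 2 := by positivity
  refine le_iInf fun m => le_iInf fun hm => le_iInf fun q => le_iInf fun hq =>
    ENNReal.ofReal_le_ofReal ?_
  -- `c - v i` is an outer normal of the side opposite to `v i`, which lies at distance `s² / 6`
  -- from the centroid in units of the length of this normal.
  obtain ⟨j, l, -, hl1, hlw, hlb⟩ := hq.exists_vertices (w := fun i => -v i - -c)
    (b := fun i => ⟪-v i - -c, c⟫ + s ^ 2 / 6) fun y hy => by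
      have hy' : y ∈ affineSpan ℝ (Set.range v) := htop ▸ AffineSubspace.mem_top ℝ E y
      obtain ⟨t, ht1, hty⟩ := eq_affineCombination_of_mem_affineSpan_of_fintype hy'
      rw [Finset.affineCombination_eq_linear_combination _ _ _ ht1] at hty
      refine mem_convexHull_of_exists_fintype t v (fun i => ?_) ht1 (fun i => ⟨i, rfl⟩) hty.symm
      have hyc : y - c = ∑ i, t i • (v i - c) := by
        simp_rw [smul_sub, Finset.sum_sub_distrib, ← Finset.sum_smul, ht1, one_smul, hty]
      have h3 := hcomb i t ht1
      have h4 := hy i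
      have h5 : -v i - -c = -(v i - c) := by abel
      simp only [h5, inner_neg_left] at h4
      rw [← hyc, inner_sub_right] at h3
      by_contra! hneg
      nlinarith [mul_neg_of_neg_of_pos hneg hs2]
  have hlw' : ∑ i, l i • (v i - c) = 0 := by
    rw [← neg_eq_zero, ← Finset.sum_neg_distrib, ← hlw]
    exact Finset.sum_congr rfl fun i _ => by rw [← smul_neg]; congr 1; abel
  have hl : ∀ i, l i = 1 / 3 := by
    intro i
    have h := hcomb i l hl1
    rw [hlw', inner_zero_right] at h
    rcases mul_eq_zero.1 h.symm with h | h <;> linarith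
  have hb' : ∑ i, l i * (⟪-v i - -c, c⟫ + s ^ 2 / 6) = s ^ 2 / 6 := by
    have h3 : ∑ i, l i * ⟪-v i - -c, c⟫ = 0 := by
      rw [← inner_zero_left (𝕜 := ℝ) c, ← hlw, sum_inner]
      exact Finset.sum_congr rfl fun i _ => by rw [inner_smul_left, conj_trivial]
    simp_rw [mul_add, Finset.sum_add_distrib, h3, ← Finset.sum_mul, hl1]
    ring
  rw [hb'] at hlb
  have h3 := sum_inner_le_of_equilateral (v := fun i => -v i) (z := -c) (R := s / 9)
    (fun i j hij => by rw [dist_neg_neg, hv i j hij]) hl1 hlw (by positivity)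
    (by rw [hl, hl, hl]; apply le_of_eq; ring) fun i => q (j i)
  have h4 := mul_le_mul_of_nonneg_left (triangle_perimeter_le_closedLength q (j 0) (j 1) (j 2))
    (show 0 ≤ s / 9 by positivity)
  have h5 : s * (3 * s / 2) ≤ s * closedLength q := by linarith
  exact le_of_mul_le_mul_left h5 hs

end Equilateral

/-! ### The billiard product of a triangle -/

theorem theorem3 (T : Affine.Triangle ℝ (EuclideanSpace ℝ (Fin 2))) :
    billiardProduct (convexHull ℝ (Set.range T.points)) ≤ 12 ∧
      (billiardProduct (convexHull ℝ (Set.range T.points)) = 12 ↔ T.Equilateral) := by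
  have hinj := T.independent.injective
  have hperm : ∀ i j k : Fin 3, i ≠ j → j ≠ k → i ≠ k →
      dist (T.points k) (T.points i) ≤ dist (T.points j) (T.points k) →
      dist (T.points i) (T.points j) ≤ dist (T.points j) (T.points k) →
      billiardProduct (convexHull ℝ (Set.range T.points)) ≤ 12 ∧
      (billiardProduct (convexHull ℝ (Set.range T.points)) = 12 →
        dist (T.points k) (T.points i) = dist (T.points j) (T.points k) ∧
        dist (T.points i) (T.points j) = dist (T.points j) (T.points k)) := by
    intro i j k hij hjk hik h1 h2
    have hrange : Set.range T.points = {T.points i, T.points j, T.points k} := by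
      have huniv : (Set.univ : Set (Fin 3)) = {i, j, k} := by
        ext x
        simp only [Set.mem_univ, Set.mem_insert_iff, Set.mem_singleton_iff, true_iff]
        omega
      rw [← Set.image_univ, huniv, Set.image_insert_eq, Set.image_pair]
    rw [hrange]
    refine billiardProduct_triangle_le (fun t ht => ?_) (hinj.ne hjk) h1 h2
    refine affineIndependent_iff_not_collinear.1 T.independent ?_
    rw [hrange, collinear_iff_of_mem (p₀ := T.points j) (by simp)]
    refine ⟨T.points k - T.points j, ?_⟩
    rintro p (rfl | rfl | rfl)
    · exact ⟨t, by rw [ht, vadd_eq_add, add_comm]⟩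
    · exact ⟨0, by simp⟩
    · exact ⟨1, by simp⟩
  have hequi : T.Equilateral → 12 ≤ billiardProduct (convexHull ℝ (Set.range T.points)) := by
    rintro ⟨s, hs⟩
    have hs0 : 0 < s := by
      rw [← hs 0 1 (by decide)]
      exact dist_pos.2 (hinj.ne (by decide))
    have htop : affineSpan ℝ (Set.range T.points) = ⊤ := by
      rw [T.independent.affineSpan_eq_top_iff_card_eq_finrank_add_one]
      simp
    refine le_iInf fun z => ?_
    have h := mul_le_mul' (le_billiardLength_of_equilateral hs0 hs htop)
      (le_billiardLength_dualBody_of_equilateral hs0 hs z)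
    rw [← ENNReal.ofReal_mul (by positivity)] at h
    have h12 : 3 * s / 2 * (8 / s) = 12 := by field_simp; norm_num
    rw [h12] at h
    simpa using h
  have hof : ∀ {s : ℝ}, dist (T.points 0) (T.points 1) = s → dist (T.points 1) (T.points 2) = s →
      dist (T.points 2) (T.points 0) = s → T.Equilateral := by
    intro s h01 h12 h20
    refine ⟨s, fun i j hij => ?_⟩
    have h10 := dist_comm (T.points 1) (T.points 0)
    have h21 := dist_comm (T.points 2) (T.points 1)
    have h02 := dist_comm (T.points 0) (T.points 2)
    fin_cases i <;> fin_cases j <;> simp_all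
  have hmain : billiardProduct (convexHull ℝ (Set.range T.points)) ≤ 12 ∧
      (billiardProduct (convexHull ℝ (Set.range T.points)) = 12 → T.Equilateral) := by
    have hA := hperm 0 1 2 (by decide) (by decide) (by decide)
    have hB := hperm 1 2 0 (by decide) (by decide) (by decide)
    have hC := hperm 2 0 1 (by decide) (by decide) (by decide)
    rcases le_total (dist (T.points 0) (T.points 1)) (dist (T.points 1) (T.points 2)) with h1 | h1
    · rcases le_total (dist (T.points 1) (T.points 2)) (dist (T.points 2) (T.points 0)) with h2 | h2
      · obtain ⟨h3, h4⟩ := hB (h1.trans h2) h2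
        exact ⟨h3, fun h => hof (h4 h).1 (h4 h).2 rfl⟩
      · obtain ⟨h3, h4⟩ := hA h2 h1
        exact ⟨h3, fun h => hof (h4 h).2 rfl (h4 h).1⟩
    · rcases le_total (dist (T.points 0) (T.points 1)) (dist (T.points 2) (T.points 0)) with h2 | h2
      · obtain ⟨h3, h4⟩ := hB h2 (h1.trans h2)
        exact ⟨h3, fun h => hof (h4 h).1 (h4 h).2 rfl⟩
      · obtain ⟨h3, h4⟩ := hC h1 h2
        exact ⟨h3, fun h => hof rfl (h4 h).1 (h4 h).2⟩
  exact ⟨hmain.1, hmain.2, fun h => le_antisymm hmain.1 (hequi h)⟩
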